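/- Let $p$ be an odd prime and let $m,k$ be positive integers. Put $e=\gcd(k,m)$ and assume that $m/e$ is odd and larger than $1$. Let $\omega_p=e^{2\pi\sqrt{-1}/p}$, let $\mathrm{Tr}:\mathbb{F}_{p^m}\to\mathbb{F}_p$, $\mathrm{Tr}(x)=\sum_{i=0}^{m-1}x^{p^i}$, be the absolute trace, and for $u,v\in\mathbb{F}_{p^m}$ let $$T(u,v)=\sum_{x\in\mathbb{F}_{p^m}}\omega_p^{\mathrm{Tr}\left(ux^{p^k+1}+vx^2\right)}.$$ Then, for each $\varepsilon\in\{1,-1\}$, the number of $u\in\mathbb{F}_{p^m}^*$ such that $T(u,1)=\varepsilon p^{\frac{m+e}{2}}$ is equal to $$\frac{p^{m-e}+\varepsilon p^{\frac{m-e}{2}}}{2}.$$ -/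

import Mathlib

/-- The exponential sum `T(u,v) = ∑_{x ∈ F} ω_p ^ Tr(u x^(p^k+1) + v x^2)`, where `F` is a finite
field of characteristic `p`, `Tr` is the absolute trace `F → ZMod p`, and
`ZMod.stdAddChar : AddChar (ZMod p) ℂ` is `a ↦ ω_p ^ a` with `ω_p = exp (2πi/p)`. -/
noncomputable def expSumT (p : ℕ) [Fact p.Prime] (F : Type*) [Field F] [Fintype F]
    [Algebra (ZMod p) F] (k : ℕ) (u v : F) : ℂ :=
  ∑ x : F, ZMod.stdAddChar (Algebra.trace (ZMod p) F (u * x ^ (p ^ k + 1) + v * x ^ 2))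

open Finset Module

section GaussSum

variable {E : Type*} [Field E] [Fintype E] [DecidableEq E]

/-- The quadratic character of a finite field with complex values. -/
noncomputable def complexQuadraticChar (E : Type*) [Field E] [Fintype E] [DecidableEq E] :
    MulChar E ℂ :=
  (quadraticChar E).ringHomComp (Int.castRingHom ℂ)

lemma complexQuadraticChar_apply (a : E) :
    complexQuadraticChar E a = ((quadraticChar E a : ℤ) : ℂ) := rfl

lemma complexQuadraticChar_sq {a : E} (ha : a ≠ 0) : complexQuadraticChar E a ^ 2 = 1 := by
  rw [complexQuadraticChar_apply]
  exact_mod_cast congrArg (Int.cast : ℤ → ℂ) (quadraticChar_sq_one ha)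

lemma complexQuadraticChar_isQuadratic : (complexQuadraticChar E).IsQuadratic :=
  (quadraticChar_isQuadratic E).comp _

lemma complexQuadraticChar_ne_one (hE : ringChar E ≠ 2) : complexQuadraticChar E ≠ 1 :=
  (MulChar.ringHomComp_ne_one_iff (RingHom.injective_int _)).mpr (quadraticChar_ne_one hE)

lemma complexQuadraticChar_gaussSum_sq (hE : ringChar E ≠ 2) {ψ : AddChar E ℂ}
    (hψ : ψ.IsPrimitive) :
    gaussSum (complexQuadraticChar E) ψ ^ 2 =
      complexQuadraticChar E (-1) * Fintype.card E :=
  gaussSum_sq (complexQuadraticChar_ne_one hE) complexQuadraticChar_isQuadratic hψ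

lemma card_filter_sq_eq (hE : ringChar E ≠ 2) (s : E) :
    ((#{t : E | t ^ 2 = s} : ℕ) : ℤ) = quadraticChar E s + 1 := by
  rw [← quadraticChar_card_sqrts hE s]
  congr 2
  ext
  simp

lemma sum_addChar_mul_sq (hE : ringChar E ≠ 2) {ψ : AddChar E ℂ} (hψ : ψ.IsPrimitive)
    {b : E} (hb : b ≠ 0) :
    ∑ t : E, ψ (b * t ^ 2) =
      complexQuadraticChar E b * gaussSum (complexQuadraticChar E) ψ := by
  have h1 : ∑ t : E, ψ (b * t ^ 2) =
      ∑ s : E, (complexQuadraticChar E s + 1) * ψ (b * s) := by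
    rw [← Finset.sum_fiberwise (s := univ) (g := fun t : E ↦ t ^ 2)]
    refine sum_congr rfl fun s _ ↦ ?_
    rw [sum_congr rfl (g := fun _ ↦ ψ (b * s)) (by simp +contextual), sum_const, nsmul_eq_mul]
    congr 1
    rw [complexQuadraticChar_apply]
    exact_mod_cast congrArg (Int.cast : ℤ → ℂ) (card_filter_sq_eq hE s)
  have h2 : ∑ s : E, ψ (b * s) = 0 := by
    simpa [hb, mul_comm] using AddChar.sum_mulShift b hψ
  have h3 := gaussSum_mulShift_eq (complexQuadraticChar E) ψ (Units.mk0 b hb)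
  rw [complexQuadraticChar_isQuadratic.inv] at h3
  rw [h1]
  simp only [add_mul, sum_add_distrib, one_mul, h2, add_zero]
  exact h3

lemma addChar_map_sum {A R ι : Type*} [AddCommMonoid A] [CommMonoid R] (ψ : AddChar A R)
    (s : Finset ι) (f : ι → A) : ψ (∑ i ∈ s, f i) = ∏ i ∈ s, ψ (f i) := by
  classical
  induction s using Finset.induction_on with
  | empty => simp
  | insert i s hi ih => rw [sum_insert hi, prod_insert hi, AddChar.map_add_eq_mul, ih]

variable {V : Type*} [AddCommGroup V] [Module E V] [FiniteDimensional E V] [Fintype V]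

/-- Exponential sums of a quadratic form over a finite field of odd characteristic, for all
scalings of the form at once. -/
lemma exists_sum_addChar_quadraticForm (hE : ringChar E ≠ 2) {ψ : AddChar E ℂ}
    (hψ : ψ.IsPrimitive) (Q : QuadraticForm E V) :
    ∃ (r : ℕ) (δ : ℂ), r + finrank E Q.radical = finrank E V ∧ δ ^ 2 = 1 ∧
      ∀ a : E, a ≠ 0 → ∑ x : V, ψ (a * Q x) =
        complexQuadraticChar E a ^ r * δ * gaussSum (complexQuadraticChar E) ψ ^ r *
          (Fintype.card E : ℂ) ^ finrank E Q.radical := by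
  have h2 : (2 : E) ≠ 0 := Ring.two_ne_zero hE
  have : NeZero (2 : E) := ⟨h2⟩
  have : Invertible (2 : E) := invertibleOfNonzero h2
  obtain ⟨w, hw⟩ := Q.equivalent_weightedSumSquares
  have hrad : finrank E Q.radical = #{i | w i = 0} := by
    rw [QuadraticForm.finrank_radical_of_equiv_weightedSumSquares hw, ← Set.ncard_coe_finset]
    simp
  refine ⟨#{i | ¬ w i = 0}, ∏ i with ¬ w i = 0, complexQuadraticChar E (w i), ?_, ?_, ?_⟩
  · rw [hrad, add_comm, Finset.card_filter_add_card_filter_not]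
    simp
  · rw [← prod_pow]
    exact prod_eq_one fun i hi ↦ complexQuadraticChar_sq (by simpa using hi)
  · intro a ha
    obtain ⟨f⟩ := hw
    have key : ∑ x : V, ψ (a * Q x) = ∏ i, ∑ t : E, ψ (a * w i * t ^ 2) := by
      rw [prod_univ_sum, Fintype.piFinset_univ, ← f.toLinearEquiv.toEquiv.sum_comp]
      refine sum_congr rfl fun x _ ↦ ?_
      rw [← addChar_map_sum, ← f.map_app, QuadraticMap.weightedSumSquares_apply, mul_sum]
      congr 1
      refine sum_congr rfl fun i _ ↦ ?_
      simp only [smul_eq_mul]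
      change _ = a * w i * (f x i) ^ 2
      ring
    rw [key, ← prod_filter_mul_prod_filter_not univ (fun i ↦ ¬ w i = 0), hrad]
    congr 1
    · rw [prod_congr rfl (g := fun i ↦ complexQuadraticChar E a * complexQuadraticChar E (w i) *
        gaussSum (complexQuadraticChar E) ψ)]
      · simp only [prod_mul_distrib, prod_const]
      · intro i hi
        rw [sum_addChar_mul_sq hE hψ (mul_ne_zero ha (by simpa using hi)), map_mul]
    · simp only [not_not]
      rw [prod_congr rfl (g := fun i ↦ (Fintype.card E : ℂ)), prod_const]
      intro i hi
      simp [(mem_filter.1 hi).2]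

end GaussSum

section TwistedForm

variable {E F : Type*} [Field E] [Field F] [Algebra E F]

/-- The quadratic form `x ↦ Tr (u x σ(x) + v x²)` on `F`. -/
noncomputable def twistedForm (σ : F ≃ₐ[E] F) (u v : F) : QuadraticForm E F :=
  LinearMap.BilinMap.toQuadraticMap
    (LinearMap.mk₂ E (fun x y ↦ Algebra.trace E F (u * x * σ y + v * x * y))
      (fun x x' y ↦ by rw [← map_add]; ring_nf)
      (fun a x y ↦ by rw [← map_smul, Algebra.smul_def, Algebra.smul_def]; ring_nf)
      (fun x y y' ↦ by simp only [map_add σ, mul_add, map_add]; abel)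
      (fun a x y ↦ by
        rw [← map_smul, map_smul, Algebra.smul_def, Algebra.smul_def, Algebra.smul_def]
        ring_nf))

lemma twistedForm_apply (σ : F ≃ₐ[E] F) (u v x : F) :
    twistedForm σ u v x = Algebra.trace E F (u * x * σ x + v * x * x) := rfl

lemma twistedForm_algebraMap_mul (σ : F ≃ₐ[E] F) (a : E) (u v x : F) :
    twistedForm σ (algebraMap E F a * u) (algebraMap E F a * v) x = a * twistedForm σ u v x := by
  rw [twistedForm_apply, twistedForm_apply, ← smul_eq_mul a, ← map_smul, Algebra.smul_def]
  ring_nf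

variable [Finite F]

omit [Finite F] in
lemma ringChar_ne_two_of_algebra (hE : ringChar E ≠ 2) : ringChar F ≠ 2 := by
  rwa [← Algebra.ringChar_eq E F]

lemma mem_radical_twistedForm (hE : ringChar E ≠ 2) (σ : F ≃ₐ[E] F) (u v x : F) :
    x ∈ (twistedForm σ u v).radical ↔ σ.symm (u * x) + u * σ x + 2 * v * x = 0 := by
  have : Finite E := Finite.of_injective _ (algebraMap E F).injective
  have : Invertible (2 : E) := invertibleOfNonzero (Ring.two_ne_zero hE)
  have key : ∀ y, (twistedForm σ u v).polarBilin x y =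
      Algebra.traceForm E F (σ.symm (u * x) + u * σ x + 2 * v * x) y := by
    intro y
    rw [twistedForm, LinearMap.BilinMap.polarBilin_toQuadraticMap, Algebra.traceForm_apply]
    simp only [LinearMap.add_apply, LinearMap.flip_apply, LinearMap.mk₂_apply]
    have h : Algebra.trace E F (u * x * σ y) = Algebra.trace E F (σ.symm (u * x) * y) := by
      rw [← Algebra.trace_eq_of_algEquiv σ.symm]
      simp
    rw [map_add, h, ← map_add, ← map_add]
    congr 1
    ring
  rw [QuadraticMap.radical_eq_ker_polarBilin, LinearMap.mem_ker]
  constructor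
  · intro h
    refine (traceForm_nondegenerate E F).1 _ fun y ↦ ?_
    rw [← key, h]
    rfl
  · intro h
    ext y
    rw [key, h]
    simp

/-- An automorphism of odd order has no eigenvalue `-1`. -/
lemma eq_zero_of_algEquiv_eq_neg (hE : ringChar E ≠ 2) (hd : Odd (finrank E F))
    (σ : F ≃ₐ[E] F) {x : F} (hx : σ x = -x) : x = 0 := by
  have : Finite E := Finite.of_injective _ (algebraMap E F).injective
  have hpow : ∀ n : ℕ, (σ ^ n) x = (-1) ^ n * x := by
    intro n
    induction n with
    | zero => simp
    | succ n ih =>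
      rw [pow_succ, AlgEquiv.mul_apply, hx, map_neg, ih]
      ring
  have h1 : σ ^ finrank E F = 1 := by
    rw [← IsGalois.card_aut_eq_finrank E F]
    exact pow_card_eq_one'
  have h2 := hpow (finrank E F)
  rw [h1, hd.neg_one_pow] at h2
  have h3 : x = -x := by simpa using h2
  exact (Ring.eq_self_iff_eq_zero_of_char_ne_two (ringChar_ne_two_of_algebra hE)).1 h3.symm

lemma add_symm_eq_zero_iff (hE : ringChar E ≠ 2) (hd : Odd (finrank E F))
    (σ : F ≃ₐ[E] F) {w : F} : w + σ.symm w = 0 ↔ w = 0 := by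
  constructor
  · exact fun h ↦ eq_zero_of_algEquiv_eq_neg hE hd σ.symm (eq_neg_of_add_eq_zero_right h)
  · rintro rfl
    simp

/-- Nonsquares stay nonsquares in extensions of odd degree. -/
lemma not_isSquare_algebraMap (hE : ringChar E ≠ 2) (hd : Odd (finrank E F))
    {σ : F ≃ₐ[E] F} (hσ : ∀ x, σ x = x → x ∈ (algebraMap E F).range) {a : E}
    (ha : ¬ IsSquare a) : ¬ IsSquare (algebraMap E F a) := by
  rintro ⟨b, hb⟩
  have h1 : σ b * σ b = b * b := by rw [← map_mul, ← hb, AlgEquiv.commutes]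
  rcases mul_self_eq_mul_self_iff.1 h1 with h | h
  · obtain ⟨c, rfl⟩ := hσ b h
    exact ha ⟨c, (algebraMap E F).injective (by rw [hb, map_mul])⟩
  · obtain rfl := eq_zero_of_algEquiv_eq_neg hE hd σ h
    rw [mul_zero, map_eq_zero] at hb
    exact ha (hb ▸ IsSquare.zero)

/-- The `E`-linear map `σ - 1`. -/
def algEquivSubOne (σ : F ≃ₐ[E] F) : F →ₗ[E] F := σ.toLinearMap - LinearMap.id

omit [Finite F] in
lemma algEquivSubOne_apply (σ : F ≃ₐ[E] F) (x : F) : algEquivSubOne σ x = σ x - x := rfl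

omit [Finite F] in
lemma ker_algEquivSubOne {σ : F ≃ₐ[E] F} (hσ : ∀ x, σ x = x → x ∈ (algebraMap E F).range) :
    LinearMap.ker (algEquivSubOne σ) = LinearMap.range (Algebra.linearMap E F) := by
  ext x
  rw [LinearMap.mem_ker, algEquivSubOne_apply, sub_eq_zero]
  constructor
  · exact hσ x
  · rintro ⟨a, rfl⟩
    exact σ.commutes a

omit [Finite F] in
lemma finrank_ker_algEquivSubOne {σ : F ≃ₐ[E] F}
    (hσ : ∀ x, σ x = x → x ∈ (algebraMap E F).range) :
    finrank E (LinearMap.ker (algEquivSubOne σ)) = 1 := by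
  rw [ker_algEquivSubOne hσ, LinearMap.finrank_range_of_inj (algebraMap E F).injective,
    finrank_self]

lemma finrank_ker_trace_add_one :
    finrank E (LinearMap.ker (Algebra.trace E F)) + 1 = finrank E F := by
  have : Finite E := Finite.of_injective _ (algebraMap E F).injective
  have h := (Algebra.trace E F).finrank_range_add_finrank_ker
  rw [LinearMap.range_eq_top.2 (Algebra.trace_surjective E F), finrank_top, finrank_self] at h
  omega

/-- Additive Hilbert 90. -/
lemma range_algEquivSubOne {σ : F ≃ₐ[E] F}
    (hσ : ∀ x, σ x = x → x ∈ (algebraMap E F).range) :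
    LinearMap.range (algEquivSubOne σ) = LinearMap.ker (Algebra.trace E F) := by
  apply Submodule.eq_of_le_of_finrank_eq
  · rintro _ ⟨x, rfl⟩
    rw [LinearMap.mem_ker, algEquivSubOne_apply, map_sub, Algebra.trace_eq_of_algEquiv, sub_self]
  · have h1 := (algEquivSubOne σ).finrank_range_add_finrank_ker
    rw [finrank_ker_algEquivSubOne hσ] at h1
    have h2 := finrank_ker_trace_add_one (E := E) (F := F)
    omega

lemma finrank_comap_span_singleton {σ : F ≃ₐ[E] F}
    (hσ : ∀ x, σ x = x → x ∈ (algebraMap E F).range) {t : F} (ht : t ≠ 0) [DecidableEq E] :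
    finrank E (Submodule.comap (algEquivSubOne σ) (E ∙ t)) =
      if Algebra.trace E F t = 0 then 2 else 1 := by
  set D := algEquivSubOne σ
  set M := Submodule.comap D (E ∙ t)
  have hle : LinearMap.ker D ≤ M := fun x hx ↦ by
    rw [Submodule.mem_comap, LinearMap.mem_ker.1 hx]
    exact zero_mem _
  have h := (D.domRestrict M).finrank_range_add_finrank_ker
  have h1 : finrank E (LinearMap.ker (D.domRestrict M)) = 1 := by
    rw [← finrank_ker_algEquivSubOne hσ, LinearMap.ker_domRestrict]
    exact (Submodule.comapSubtypeEquivOfLe hle).finrank_eq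
  rw [h1, LinearMap.range_domRestrict, Submodule.map_comap_eq, range_algEquivSubOne hσ] at h
  rw [← h]
  split_ifs with h0
  · rw [inf_eq_right.2, finrank_span_singleton ht]
    rwa [Submodule.span_singleton_le_iff_mem]
  · suffices hbot : LinearMap.ker (Algebra.trace E F) ⊓ (E ∙ t) = ⊥ by rw [hbot, finrank_bot]
    rw [Submodule.eq_bot_iff]
    rintro x ⟨hx, hx'⟩
    obtain ⟨a, rfl⟩ := Submodule.mem_span_singleton.1 hx'
    have hx2 : Algebra.trace E F (a • t) = 0 := hx
    rw [map_smul, smul_eq_mul, mul_eq_zero] at hx2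
    rw [hx2.resolve_right h0, zero_smul]

/-- The radical of `twistedForm σ u 1`, if nonzero, is at most two-dimensional; its dimension is
detected by a trace. -/
lemma finrank_radical_twistedForm (hE : ringChar E ≠ 2) {σ : F ≃ₐ[E] F}
    (hσ : ∀ x, σ x = x → x ∈ (algebraMap E F).range) {u x : F} (hx : x ≠ 0)
    (hmem : x ∈ (twistedForm σ u 1).radical) [DecidableEq E] :
    finrank E (twistedForm σ u 1).radical =
      if Algebra.trace E F (u * x * σ x)⁻¹ = 0 then 2 else 1 := by
  have h2 : (2 : F) ≠ 0 := Ring.two_ne_zero (ringChar_ne_two_of_algebra hE)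
  rw [mem_radical_twistedForm hE] at hmem
  have hu : u ≠ 0 := by
    rintro rfl
    simp [hx, h2] at hmem
  have hσx : σ x ≠ 0 := by simpa using hx
  have hw : u * x * σ x ≠ 0 := mul_ne_zero (mul_ne_zero hu hx) hσx
  have key : ∀ s, x * s ∈ (twistedForm σ u 1).radical ↔
      s ∈ Submodule.comap (algEquivSubOne σ) (E ∙ (u * x * σ x)⁻¹) := by
    intro s
    have e1 : σ.symm (u * (x * s)) + u * σ (x * s) + 2 * 1 * (x * s) = 0 ↔
        σ (u * x * σ x * (σ s - s)) = u * x * σ x * (σ s - s) := by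
      have h3 : σ.symm (u * x * σ x * (σ s - s)) = σ.symm (u * x) * x * (s - σ.symm s) := by
        simp only [map_mul, map_sub, AlgEquiv.symm_apply_apply]
      have h4 : x * (σ.symm (u * (x * s)) + u * σ (x * s) + 2 * 1 * (x * s)) =
          u * x * σ x * (σ s - s) - σ.symm (u * x * σ x * (σ s - s)) := by
        rw [h3, ← mul_assoc u x s, map_mul σ.symm (u * x), map_mul σ x]
        linear_combination x * s * hmem
      rw [← mul_eq_zero_iff_left hx, h4, sub_eq_zero, AlgEquiv.eq_symm_apply]
    rw [mem_radical_twistedForm hE, e1, Submodule.mem_comap, Submodule.mem_span_singleton,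
      algEquivSubOne_apply]
    constructor
    · intro h
      obtain ⟨a, ha⟩ := hσ _ h
      refine ⟨a, ?_⟩
      rw [Algebra.smul_def, ha]
      field_simp
    · rintro ⟨a, ha⟩
      rw [← ha, Algebra.smul_def, mul_left_comm, mul_inv_cancel₀ hw, mul_one, AlgEquiv.commutes]
  have heq : (twistedForm σ u 1).radical =
      Submodule.map (DistribMulAction.toLinearEquiv E F (Units.mk0 x hx)).toLinearMap
        (Submodule.comap (algEquivSubOne σ) (E ∙ (u * x * σ x)⁻¹)) := by
    ext y
    rw [Submodule.mem_map]
    constructor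
    · intro hy
      refine ⟨x⁻¹ * y, (key _).1 (by rwa [mul_inv_cancel_left₀ hx]), ?_⟩
      exact mul_inv_cancel_left₀ hx y
    · rintro ⟨s, hs, rfl⟩
      exact (key s).2 hs
  rw [← finrank_comap_span_singleton hσ (inv_ne_zero hw), heq]
  exact LinearEquiv.finrank_map_eq _ _

end TwistedForm

section TwistedFormCount

variable {E F : Type*} [Field E] [Field F] [Algebra E F] [Fintype E] [Fintype F]

open scoped Classical in
lemma card_trace_eq_zero :
    #{t : F | Algebra.trace E F t = 0} = Fintype.card E ^ (finrank E F - 1) := by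
  have h := finrank_ker_trace_add_one (E := E) (F := F)
  rw [show finrank E F - 1 = finrank E (LinearMap.ker (Algebra.trace E F)) by omega,
    ← Module.card_eq_pow_finrank (K := E), Fintype.card_subtype]
  rfl

open scoped Classical in
lemma card_trace_ne_zero :
    #{t : F | Algebra.trace E F t ≠ 0} =
      Fintype.card E ^ (finrank E F - 1) * (Fintype.card E - 1) := by
  have h := Finset.card_filter_add_card_filter_not (s := (univ : Finset F))
    (fun t ↦ Algebra.trace E F t = 0)
  have h0 : 0 < finrank E F := finrank_pos
  rw [card_trace_eq_zero, card_univ,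
    Module.card_eq_pow_finrank (K := E) (V := F)] at h
  have h1 : Fintype.card E ^ finrank E F =
      Fintype.card E ^ (finrank E F - 1) * Fintype.card E := by
    rw [← pow_succ, Nat.sub_add_cancel h0]
  rw [Nat.mul_sub, mul_one, ← h1, ← h]
  simp

open scoped Classical in
lemma card_trace_inv_ne_zero :
    #{w : F | Algebra.trace E F w⁻¹ ≠ 0} =
      Fintype.card E ^ (finrank E F - 1) * (Fintype.card E - 1) := by
  rw [← card_trace_ne_zero (F := F)]
  refine card_bij (fun w _ ↦ w⁻¹) (by simp) (by simp) fun t ht ↦ ⟨t⁻¹, by simpa using ht, by simp⟩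

open scoped Classical in
/-- Multiplication by a nonsquare of `E` shows that half of the values `-(w + σ⁻¹ w) / 2` are
squares. -/
lemma sum_card_sqrt (hE : ringChar E ≠ 2) (hd : Odd (finrank E F)) {σ : F ≃ₐ[E] F}
    (hσ : ∀ x, σ x = x → x ∈ (algebraMap E F).range) :
    ∑ w : F with Algebra.trace E F w⁻¹ ≠ 0, #{x : F | x ^ 2 = -(w + σ.symm w) / 2} =
      #{w : F | Algebra.trace E F w⁻¹ ≠ 0} := by
  have hF : ringChar F ≠ 2 := ringChar_ne_two_of_algebra hE
  obtain ⟨a, ha⟩ := FiniteField.exists_nonsquare hE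
  have ha0 : a ≠ 0 := by
    rintro rfl
    exact ha IsSquare.zero
  have hA : quadraticChar F (algebraMap E F a) = -1 :=
    quadraticChar_neg_one_iff_not_isSquare.2 (not_isSquare_algebraMap hE hd hσ ha)
  have hA0 : algebraMap E F a ≠ 0 := by simpa using ha0
  set S : Finset F := {w : F | Algebra.trace E F w⁻¹ ≠ 0}
  have hflip : ∑ w ∈ S, quadraticChar F (-(w + σ.symm w) / 2) =
      ∑ w ∈ S, -quadraticChar F (-(w + σ.symm w) / 2) := by
    have htr : ∀ w : F, Algebra.trace E F (algebraMap E F a * w)⁻¹ =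
        a⁻¹ * Algebra.trace E F w⁻¹ := by
      intro w
      rw [mul_inv, ← map_inv₀, ← Algebra.smul_def, map_smul, smul_eq_mul]
    symm
    refine sum_bij (fun w _ ↦ algebraMap E F a * w) ?_ ?_ ?_ ?_
    · intro w hw
      simp only [S, mem_filter, mem_univ, true_and] at hw ⊢
      rw [htr]
      exact mul_ne_zero (inv_ne_zero ha0) hw
    · intro w _ w' _ h
      exact mul_left_cancel₀ hA0 h
    · intro w hw
      refine ⟨(algebraMap E F a)⁻¹ * w, ?_, by rw [mul_inv_cancel_left₀ hA0]⟩
      simp only [S, mem_filter, mem_univ, true_and] at hw ⊢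
      intro h
      apply hw
      have := htr ((algebraMap E F a)⁻¹ * w)
      rwa [h, mul_zero, mul_inv_cancel_left₀ hA0] at this
    · intro w _
      rw [map_mul, AlgEquiv.commutes, ← mul_add, ← mul_neg, mul_div_assoc, map_mul, hA, neg_one_mul]
  have hzero : ∑ w ∈ S, quadraticChar F (-(w + σ.symm w) / 2) = 0 := by
    rw [sum_neg_distrib] at hflip
    omega
  have : ((∑ w ∈ S, #{x : F | x ^ 2 = -(w + σ.symm w) / 2} : ℕ) : ℤ) = (#S : ℕ) := by
    push_cast
    simp only [card_filter_sq_eq hF, sum_add_distrib, hzero, zero_add]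
    simp
  exact_mod_cast this

open scoped Classical in
/-- The number of `u` for which the radical is a line. -/
lemma card_finrank_radical_eq_one (hE : ringChar E ≠ 2) (hd : Odd (finrank E F)) {σ : F ≃ₐ[E] F}
    (hσ : ∀ x, σ x = x → x ∈ (algebraMap E F).range) :
    #{u : F | finrank E (twistedForm σ u 1).radical = 1} =
      Fintype.card E ^ (finrank E F - 1) := by
  have h2 : (2 : F) ≠ 0 := Ring.two_ne_zero (ringChar_ne_two_of_algebra hE)
  set N : Finset F := {u : F | finrank E (twistedForm σ u 1).radical = 1}
  have hq : 0 < Fintype.card E - 1 := Nat.sub_pos_of_lt Fintype.one_lt_card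
  refine Nat.eq_of_mul_eq_mul_right hq ?_
  have h1 : #(N.sigma fun u ↦ {x : F | x ∈ (twistedForm σ u 1).radical ∧ x ≠ 0}) =
      #N * (Fintype.card E - 1) := by
    rw [card_sigma, sum_congr rfl (g := fun _ ↦ Fintype.card E - 1), sum_const, smul_eq_mul]
    intro u hu
    have hcard : #{x : F | x ∈ (twistedForm σ u 1).radical} = Fintype.card E := by
      have h := Module.card_eq_pow_finrank (K := E) (V := (twistedForm σ u 1).radical)
      rw [(mem_filter.1 hu).2, pow_one, Fintype.card_subtype] at h
      exact h
    rw [← hcard, filter_and_not, ← card_singleton (0 : F), ← card_sdiff_of_subset]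
    · congr 1
      ext
      simp
    · simp
  rw [← h1, ← card_trace_inv_ne_zero (F := F), ← sum_card_sqrt hE hd hσ, ← card_sigma]
  have hw : ∀ {u x : F}, x ≠ 0 → (x ∈ (twistedForm σ u 1).radical ↔
      x ^ 2 = -(u * x * σ x + σ.symm (u * x * σ x)) / 2) := by
    intro u x hx
    rw [mem_radical_twistedForm hE, map_mul σ.symm (u * x), AlgEquiv.symm_apply_apply, eq_div_iff h2,
      ← mul_eq_zero_iff_left hx, ← sub_eq_zero (a := x ^ 2 * 2)]
    ring_nf
  refine card_bij (fun p _ ↦ ⟨p.1 * p.2 * σ p.2, p.2⟩) ?_ ?_ ?_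
  · rintro ⟨u, x⟩ h
    simp only [N, mem_sigma, mem_filter, mem_univ, true_and] at h ⊢
    obtain ⟨h1, h2, h3⟩ := h
    refine ⟨fun h0 ↦ ?_, (hw h3).1 h2⟩
    rw [finrank_radical_twistedForm hE hσ h3 h2, if_pos h0] at h1
    omega
  · rintro ⟨u, x⟩ h ⟨u', x'⟩ h' heq
    simp only [mem_sigma, mem_filter, mem_univ, true_and] at h h'
    simp only [Sigma.mk.injEq, heq_eq_eq] at heq ⊢
    obtain ⟨h1, rfl⟩ := heq
    have hx : x ≠ 0 := h.2.2
    have hσx : σ x ≠ 0 := by simpa using hx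
    exact ⟨mul_right_cancel₀ hx (mul_right_cancel₀ hσx h1), rfl⟩
  · rintro ⟨w, x⟩ h
    simp only [mem_sigma, mem_filter, mem_univ, true_and] at h
    obtain ⟨htr, hx⟩ := h
    have hw0 : w ≠ 0 := by
      rintro rfl
      simp at htr
    have hx0 : x ≠ 0 := by
      rintro rfl
      rw [eq_div_iff h2] at hx
      apply hw0
      rw [← add_symm_eq_zero_iff hE hd σ]
      linear_combination hx
    have hσx : σ x ≠ 0 := by simpa using hx0
    have hw' : w / (x * σ x) * x * σ x = w := by field_simp
    have hmem : x ∈ (twistedForm σ (w / (x * σ x)) 1).radical := by rw [hw hx0, hw', hx]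
    refine ⟨⟨w / (x * σ x), x⟩, ?_, ?_⟩
    · simp only [N, mem_sigma, mem_filter, mem_univ, true_and]
      refine ⟨?_, hmem, hx0⟩
      rw [finrank_radical_twistedForm hE hσ hx0 hmem, hw', if_neg htr]
    · simp only [hw']

/-- The exponential sum of `twistedForm σ u v`. -/
noncomputable def twistedSum (ψ : AddChar E ℂ) (σ : F ≃ₐ[E] F) (u v : F) : ℂ :=
  ∑ x : F, ψ (twistedForm σ u v x)

lemma sum_twistedSum {ψ : AddChar E ℂ} (hψ : ψ.IsPrimitive) (σ : F ≃ₐ[E] F) (v : F) :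
    ∑ u : F, twistedSum ψ σ u v = (Fintype.card E : ℂ) ^ finrank E F := by
  classical
  simp only [twistedSum]
  have hΨ : (ψ.compAddMonoidHom (Algebra.trace E F).toAddMonoidHom).IsPrimitive := by
    apply AddChar.IsPrimitive.of_ne_one
    intro h
    have h1 : ψ ≠ 1 := by simpa using hψ one_ne_zero
    apply h1
    ext a
    obtain ⟨x, rfl⟩ := Algebra.trace_surjective E F a
    exact DFunLike.congr_fun h x
  rw [sum_comm, sum_eq_single 0]
  · simp [Module.card_eq_pow_finrank (K := E) (V := F)]
  · intro x _ hx
    have h := AddChar.sum_mulShift (x * σ x) hΨ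
    rw [if_neg (by simpa using hx)] at h
    simp only [twistedForm_apply, map_add, AddChar.map_add_eq_mul, ← sum_mul]
    refine mul_eq_zero_of_left ?_ _
    simp only [mul_assoc]
    exact_mod_cast h
  · simp

lemma sum_twistedSum_algebraMap {ψ : AddChar E ℂ} (hψ : ψ.IsPrimitive) (σ : F ≃ₐ[E] F) {a : E}
    (ha : a ≠ 0) :
    ∑ u : F, ∑ x : F, ψ (a * twistedForm σ u 1 x) = (Fintype.card E : ℂ) ^ finrank E F := by
  have hA : algebraMap E F a ≠ 0 := by simpa using ha
  rw [← sum_twistedSum hψ σ (algebraMap E F a),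
    ← Equiv.sum_comp (Equiv.mulLeft₀ _ hA) fun u ↦ twistedSum ψ σ u (algebraMap E F a)]
  refine sum_congr rfl fun u _ ↦ sum_congr rfl fun x _ ↦ ?_
  rw [← twistedForm_algebraMap_mul, mul_one]
  rfl

omit [Fintype E] in
lemma finrank_radical_le_two (hE : ringChar E ≠ 2) {σ : F ≃ₐ[E] F}
    (hσ : ∀ x, σ x = x → x ∈ (algebraMap E F).range) (u : F) :
    finrank E (twistedForm σ u 1).radical ≤ 2 := by
  classical
  by_cases h : ∃ x ∈ (twistedForm σ u 1).radical, x ≠ 0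
  · obtain ⟨x, hx, hx0⟩ := h
    rw [finrank_radical_twistedForm hE hσ hx0 hx]
    split_ifs <;> norm_num
  · push Not at h
    rw [(Submodule.eq_bot_iff _).2 h, finrank_bot]
    norm_num

open scoped Classical in
lemma sum_twistedSum_finrank_eq_one (hE : ringChar E ≠ 2) (hd : Odd (finrank E F))
    {σ : F ≃ₐ[E] F} (hσ : ∀ x, σ x = x → x ∈ (algebraMap E F).range)
    {ψ : AddChar E ℂ} (hψ : ψ.IsPrimitive) :
    ∑ u : F with finrank E (twistedForm σ u 1).radical = 1, twistedSum ψ σ u 1 =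
      (Fintype.card E : ℂ) ^ finrank E F := by
  obtain ⟨a, ha⟩ := FiniteField.exists_nonsquare hE
  have ha0 : a ≠ 0 := by
    rintro rfl
    exact ha IsSquare.zero
  have hA : complexQuadraticChar E a = -1 := by
    rw [complexQuadraticChar_apply, quadraticChar_neg_one_iff_not_isSquare.2 ha]
    norm_num
  have hflip : ∀ u : F, twistedSum ψ σ u 1 + ∑ x : F, ψ (a * twistedForm σ u 1 x) =
      if finrank E (twistedForm σ u 1).radical = 1 then 2 * twistedSum ψ σ u 1 else 0 := by
    intro u
    obtain ⟨r, δ, hr, -, h⟩ := exists_sum_addChar_quadraticForm hE hψ (twistedForm σ u 1)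
    have h1 := h 1 one_ne_zero
    simp only [one_mul, map_one, one_pow] at h1
    have h2 := finrank_radical_le_two hE hσ u
    rw [h a ha0, hA, twistedSum, h1]
    split_ifs with hc
    · have hr' : Even r := by
        rw [hc] at hr
        grind
      rw [hr'.neg_one_pow]
      ring
    · have hr' : Odd r := by
        have : finrank E (twistedForm σ u 1).radical = 0 ∨
          finrank E (twistedForm σ u 1).radical = 2 := by omega
        grind
      rw [hr'.neg_one_pow]
      ring
  have hsum := sum_congr rfl fun u (_ : u ∈ (univ : Finset F)) ↦ hflip u
  rw [sum_add_distrib, sum_twistedSum hψ, sum_twistedSum_algebraMap hψ σ ha0, ← sum_filter,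
    ← mul_sum] at hsum
  linear_combination -(1 / 2) * hsum

lemma twistedSum_sq (hE : ringChar E ≠ 2) {ψ : AddChar E ℂ} (hψ : ψ.IsPrimitive)
    (σ : F ≃ₐ[E] F) (u v : F) :
    ∃ r : ℕ, r + finrank E (twistedForm σ u v).radical = finrank E F ∧
      ∃ η : ℂ, η ^ 2 = 1 ∧ twistedSum ψ σ u v ^ 2 = η ^ r *
        (Fintype.card E : ℂ) ^ (finrank E F + finrank E (twistedForm σ u v).radical) := by
  classical
  obtain ⟨r, δ, hr, hδ, h⟩ := exists_sum_addChar_quadraticForm hE hψ (twistedForm σ u v)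
  have h1 := h 1 one_ne_zero
  simp only [one_mul, map_one, one_pow] at h1
  refine ⟨r, hr, complexQuadraticChar E (-1), complexQuadraticChar_sq (by simp), ?_⟩
  rw [twistedSum, h1, mul_pow, mul_pow, hδ, one_mul, pow_right_comm,
    complexQuadraticChar_gaussSum_sq hE hψ, mul_pow, mul_assoc, ← pow_mul, ← pow_add, ← hr]
  ring_nf

lemma finrank_radical_eq_one_iff (hE : ringChar E ≠ 2) (hd : Odd (finrank E F))
    {ψ : AddChar E ℂ} (hψ : ψ.IsPrimitive) (σ : F ≃ₐ[E] F) (u v : F) :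
    finrank E (twistedForm σ u v).radical = 1 ↔
      twistedSum ψ σ u v ^ 2 = (Fintype.card E : ℂ) ^ (finrank E F + 1) := by
  obtain ⟨r, hr, η, hη, h⟩ := twistedSum_sq hE hψ σ u v
  rw [h]
  constructor
  · intro hc
    rw [hc] at hr ⊢
    obtain ⟨s, rfl⟩ : Even r := by grind
    rw [← two_mul, pow_mul, hη, one_pow, one_mul]
  · intro hT
    have hη1 : ‖η‖ = 1 := by
      have := congrArg norm hη
      rw [norm_pow, norm_one] at this
      exact (pow_eq_one_iff_of_nonneg (norm_nonneg _) two_ne_zero).1 this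
    have hn := congrArg norm hT
    rw [norm_mul, norm_pow, norm_pow, norm_pow, hη1, one_pow, one_mul, Complex.norm_natCast] at hn
    have hn' : Fintype.card E ^ (finrank E F + finrank E (twistedForm σ u v).radical) =
        Fintype.card E ^ (finrank E F + 1) := by exact_mod_cast hn
    have := Nat.pow_right_injective (Fintype.one_lt_card (α := E)) hn'
    omega

open scoped Classical in
/-- The number of `u` for which the exponential sum of `Tr (u x σ(x) + x²)` takes one of the two
values of absolute value `q ^ ((d + 1) / 2)`. -/
theorem card_twistedSum_eq (hE : ringChar E ≠ 2) {n : ℕ} (hn : finrank E F = 2 * n + 1)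
    {σ : F ≃ₐ[E] F} (hσ : ∀ x, σ x = x → x ∈ (algebraMap E F).range)
    {ψ : AddChar E ℂ} (hψ : ψ.IsPrimitive) {ε : ℤ} (hε : ε = 1 ∨ ε = -1) :
    2 * (#{u : F | twistedSum ψ σ u 1 = ε * (Fintype.card E : ℂ) ^ (n + 1)} : ℤ) =
      (Fintype.card E : ℤ) ^ (2 * n) + ε * (Fintype.card E : ℤ) ^ n := by
  have hd : Odd (finrank E F) := ⟨n, hn⟩
  set q := Fintype.card E
  have hq : (q : ℂ) ≠ 0 := by simp [q]
  set A : ℤ → Finset F := fun ε ↦ {u : F | twistedSum ψ σ u 1 = ε * (q : ℂ) ^ (n + 1)}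
  have hiff : ∀ u : F, finrank E (twistedForm σ u 1).radical = 1 ↔
      twistedSum ψ σ u 1 = (q : ℂ) ^ (n + 1) ∨ twistedSum ψ σ u 1 = -(q : ℂ) ^ (n + 1) := by
    intro u
    rw [finrank_radical_eq_one_iff hE hd hψ, hn, ← sq_eq_sq_iff_eq_or_eq_neg, ← pow_mul,
      show (n + 1) * 2 = 2 * n + 1 + 1 by ring]
  have hN : ({u : F | finrank E (twistedForm σ u 1).radical = 1} : Finset F) = A 1 ∪ A (-1) := by
    ext u
    simp [A, hiff]
  have hdisj : Disjoint (A 1) (A (-1)) := by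
    rw [disjoint_left]
    intro u h1 h2
    simp only [A, mem_filter, mem_univ, true_and, Int.cast_one, Int.cast_neg, one_mul,
      neg_mul] at h1 h2
    rw [h1, self_eq_neg] at h2
    exact pow_ne_zero _ hq h2
  have hcount := card_finrank_radical_eq_one hE hd hσ
  have hmom := sum_twistedSum_finrank_eq_one hE hd hσ hψ
  have hval : ∀ ε : ℤ, ∑ u ∈ A ε, twistedSum ψ σ u 1 = #(A ε) * (ε * (q : ℂ) ^ (n + 1)) := by
    intro ε
    rw [sum_congr rfl (g := fun _ ↦ ε * (q : ℂ) ^ (n + 1)) (by simp +contextual [A]), sum_const,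
      nsmul_eq_mul]
  rw [hN, card_union_of_disjoint hdisj, hn, Nat.add_sub_cancel] at hcount
  rw [hN, sum_union hdisj, hval, hval, hn] at hmom
  have hdiff : (#(A 1) : ℤ) - #(A (-1)) = (q : ℤ) ^ n := by
    have : (#(A 1) : ℂ) - #(A (-1)) = (q : ℂ) ^ n := by
      apply mul_right_cancel₀ (pow_ne_zero (n + 1) hq)
      push_cast at hmom
      rw [← pow_add, show n + (n + 1) = 2 * n + 1 by ring, ← hmom]
      ring
    exact_mod_cast this
  have hadd : (#(A 1) : ℤ) + #(A (-1)) = (q : ℤ) ^ (2 * n) := by exact_mod_cast hcount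
  change 2 * (#(A ε) : ℤ) = _
  rcases hε with rfl | rfl <;> linarith

end TwistedFormCount

lemma radical_twistedForm_zero {E F : Type*} [Field E] [Field F] [Algebra E F] [Finite F]
    (hE : ringChar E ≠ 2) (σ : F ≃ₐ[E] F) : (twistedForm σ 0 1).radical = ⊥ := by
  have h2 : (2 : F) ≠ 0 := Ring.two_ne_zero (ringChar_ne_two_of_algebra hE)
  rw [Submodule.eq_bot_iff]
  intro x hx
  rw [mem_radical_twistedForm hE] at hx
  simpa [h2] using hx

theorem proposition1 (p : ℕ) [Fact p.Prime] (hp : Odd p)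
    (m k e : ℕ) (hm : 0 < m) (hk : 0 < k) (he : e = Nat.gcd k m)
    (hodd : Odd (m / e)) (hlarge : 1 < m / e)
    (F : Type*) [Field F] [Fintype F] [Algebra (ZMod p) F] (hF : Fintype.card F = p ^ m)
    (ε : ℤ) (hε : ε = 1 ∨ ε = -1) :
    (Set.ncard {u : F | u ≠ 0 ∧ expSumT p F k u 1 = (ε : ℂ) * (p : ℂ) ^ ((m + e) / 2)} : ℚ) =
      ((p : ℚ) ^ (m - e) + (ε : ℚ) * (p : ℚ) ^ ((m - e) / 2)) / 2 := by
  classical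
  have hp1 : 1 < p := (Fact.out : p.Prime).one_lt
  obtain ⟨n, hn⟩ := hodd
  have hme : m = e * (2 * n + 1) := by
    rw [← hn, Nat.mul_div_cancel' (he ▸ Nat.gcd_dvd_right k m)]
  have hfinF : finrank (ZMod p) F = m := by
    have h := Module.card_eq_pow_finrank (K := ZMod p) (V := F)
    rw [hF, ZMod.card] at h
    exact (Nat.pow_right_injective hp1 h).symm
  set τ : F ≃ₐ[ZMod p] F := FiniteField.frobeniusAlgEquivOfAlgebraic (ZMod p) F ^ k with hτ
  have hτ_apply : ∀ x, τ x = x ^ p ^ k := by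
    intro x
    rw [hτ, AlgEquiv.coe_pow, FiniteField.coe_frobeniusAlgEquivOfAlgebraic_iterate, ZMod.card]
  let E := IntermediateField.fixedField (Subgroup.zpowers τ)
  have hτE : τ ∈ E.fixingSubgroup :=
    (IntermediateField.le_iff_le _ _).1 le_rfl (Subgroup.mem_zpowers τ)
  let σ : F ≃ₐ[E] F := IntermediateField.fixingSubgroupEquiv E ⟨τ, hτE⟩
  have hσ_apply : ∀ x, σ x = x ^ p ^ k := hτ_apply
  have hσ : ∀ x, σ x = x → x ∈ (algebraMap E F).range := by
    intro x hx
    have hxE : x ∈ E := by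
      rw [IntermediateField.mem_fixedField_iff]
      intro g hg
      have hle : Subgroup.zpowers τ ≤ MulAction.stabilizer (F ≃ₐ[ZMod p] F) x :=
        Subgroup.zpowers_le.2 hx
      exact hle hg
    exact ⟨⟨x, hxE⟩, rfl⟩
  have hfin : finrank E F = 2 * n + 1 := by
    rw [IntermediateField.finrank_fixedField_eq_card, Nat.card_zpowers, hτ, orderOf_pow,
      FiniteField.orderOf_frobeniusAlgEquivOfAlgebraic, hfinF, Nat.gcd_comm, ← he, hn]
  have : Fintype E := Fintype.ofFinite E
  have hcardE : Fintype.card E = p ^ e := by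
    have h := Module.card_eq_pow_finrank (K := ZMod p) (V := E)
    have h' := finrank_mul_finrank (ZMod p) E F
    rw [hfin, hfinF, hme] at h'
    rw [h, ZMod.card, Nat.eq_of_mul_eq_mul_right (by omega) h']
  have hE : ringChar E ≠ 2 := by
    rw [← Algebra.ringChar_eq (ZMod p) E, ZMod.ringChar_zmod_n]
    rintro rfl
    exact absurd hp (by decide)
  let ψ : AddChar E ℂ :=
    (ZMod.stdAddChar (N := p)).compAddMonoidHom (Algebra.trace (ZMod p) E).toAddMonoidHom
  have hψ : ψ.IsPrimitive := by
    apply AddChar.IsPrimitive.of_ne_one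
    intro h
    have h1 : (ZMod.stdAddChar (N := p)) ≠ 1 := by
      simpa using ZMod.isPrimitive_stdAddChar p one_ne_zero
    apply h1
    ext a
    obtain ⟨x, rfl⟩ := Algebra.trace_surjective (ZMod p) E a
    exact DFunLike.congr_fun h x
  have hT : ∀ u : F, expSumT p F k u 1 = twistedSum ψ σ u 1 := by
    intro u
    refine sum_congr rfl fun x _ ↦ ?_
    change _ = ZMod.stdAddChar (Algebra.trace (ZMod p) E (twistedForm σ u 1 x))
    rw [twistedForm_apply, Algebra.trace_trace, hσ_apply]
    ring_nf
  have hset : {u : F | u ≠ 0 ∧ expSumT p F k u 1 = (ε : ℂ) * (p : ℂ) ^ ((m + e) / 2)} =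
      ({u : F | twistedSum ψ σ u 1 = ε * (Fintype.card E : ℂ) ^ (n + 1)} : Finset F) := by
    have hexp : (m + e) / 2 = e * (n + 1) := by
      rw [hme, show e * (2 * n + 1) + e = e * (n + 1) * 2 by ring, Nat.mul_div_cancel _ two_pos]
    ext u
    simp only [hT, hexp, hcardE, Set.mem_ofPred_eq, coe_filter, mem_univ, true_and, Nat.cast_pow,
      ← pow_mul]
    refine and_iff_right_of_imp ?_
    rintro h rfl
    have h1 : finrank E (twistedForm σ 0 1).radical = 1 := by
      have hε2 : (ε : ℂ) ^ 2 = 1 := by rcases hε with rfl | rfl <;> norm_num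
      rw [finrank_radical_eq_one_iff hE ⟨n, hfin⟩ hψ, h, mul_pow, hε2, one_mul, hcardE, hfin,
        Nat.cast_pow, ← pow_mul, ← pow_mul]
      ring_nf
    rw [radical_twistedForm_zero hE, finrank_bot] at h1
    omega
  have hcount := card_twistedSum_eq hE hfin hσ hψ hε
  rw [hset, Set.ncard_coe_finset, eq_div_iff two_ne_zero, mul_comm]
  have hsub : m - e = e * (2 * n) := by rw [hme, mul_add, mul_one, Nat.add_sub_cancel]
  have hhalf : (m - e) / 2 = e * n := by
    rw [hsub, show e * (2 * n) = e * n * 2 by ring, Nat.mul_div_cancel _ two_pos]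
  rw [hhalf, hsub, pow_mul (p : ℚ) e, pow_mul (p : ℚ) e]
  rw [hcardE] at hcount ⊢
  exact_mod_cast hcount
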